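/- Let $(\mathscr W,\otimes,I)$ be a monoidal category (strict or not; associators, unitors and the isomorphism $I\cong I\otimes I$ are suppressed below) that is monoidally locally finitely presentable: $\mathscr W$ is locally finitely presentable, $I$ is finitely presentable, $A\otimes B$ is finitely presentable whenever $A$ and $B$ are, every functor ${-}\otimes W$ preserves finite coproducts, and $\otimes$ preserves filtered colimits in each variable. Let $H:\mathscr W\to\mathscr W$ be a functor preserving filtered colimits. A *pointed object* is a pair $(X,x)$ with $x:I\to X$, i.e. an object of $I/\mathscr W$; $(X\otimes Y,x\otimes y)$ is again pointed. A *point-strength* of an endofunctor $M$ is a family of morphisms $s_{(X,x),(Y,y)}:MX\otimes Y\to M(X\otimes Y)$, natural in $(X,x),(Y,y)\in I/\mathscr W$, such that $s_{(X,x),(I,\mathrm{id})}=\mathrm{id}_{MX}$ and $s_{(X,x),(Y\otimes Z,y\otimes z)}=s_{(X\otimes Y,x\otimes y),(Z,z)}\cdot(s_{(X,x),(Y,y)}\otimes Z)$. A *point-strong monad* is a monad $(M,\eta,\mu)$ with a point-strength $s$ of $M$ such that, for all $(X,x)$, $(Y,y)$, $$s_{(X,x),(Y,y)}\cdot(\eta_X\otimes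 Y)=\eta_{X\otimes Y},\qquad s_{(X,x),(Y,y)}\cdot(\mu_X\otimes Y)=\mu_{X\otimes Y}\cdot Ms_{(X,x),(Y,y)}\cdot s_{(MX,\eta_X\cdot x),(Y,y)} .$$ An $H$-algebra $a:HA\to A$ is *iterative* if for every finitely presentable $X$ and every $e:X\to HX+A$ there is a unique $e^\dagger:X\to A$ with $e^\dagger=[a,\mathrm{id}_A]\cdot(He^\dagger+\mathrm{id}_A)\cdot e$. A free iterative $H$-algebra on $Y$ is an iterative algebra $\varrho_Y:HRY\to RY$ with a morphism $\eta_Y:Y\to RY$ such that every morphism from $Y$ to an iterative algebra $B$ factorizes through $\eta_Y$ by a unique $H$-algebra homomorphism $RY\to B$. **Theorem 3.10.** Suppose $H$ has a point-strength $s^H$. Then a free iterative $H$-algebra $(RY,\varrho_Y,\eta_Y)$ exists on every object $Y$. For any choice of these, let $\mathbb R=(R,\eta,\mu)$ be the resulting rational monad of $H$: $Rf$ is the homomorphism extending $\eta_Z\cdot f$ for $f:Y\to Z$, and $\mu_Y:RRY\to RY$ is the homomorphism with $\mu_Y\cdot\eta_{RY}=\mathrm{id}_{RY}$. Then among all families $s_{(X,x),(Y,y)}:RX\otimes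 Y\to R(X\otimes Y)$ natural in $(X,x),(Y,y)\in I/\mathscr W$ there is exactly one, $s^R$, such that for all $(X,x)$, $(Y,y)$ $$s^R_{(X,x),(Y,y)}\cdot(\varrho_X\otimes Y)=\varrho_{X\otimes Y}\cdot Hs^R_{(X,x),(Y,y)}\cdot s^H_{(RX,\eta_X\cdot x),(Y,y)},\qquad s^R_{(X,x),(Y,y)}\cdot(\eta_X\otimes Y)=\eta_{X\otimes Y},$$ and $s^R$ is a point-strength of $R$ making $\mathbb R$ a point-strong monad. -/

import Mathlib

open CategoryTheory MonoidalCategory Limits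

universe v u

namespace RationalStrength

/-! ## Monoidally locally finitely presentable categories -/

/-- A monoidal category is monoidally locally finitely presentable if it is locally finitely
presentable (with respect to the universe of its hom-sets), the unit is finitely presentable,
finitely presentable objects are closed under `⊗`, every functor `- ⊗ Y` preserves finite
coproducts, and `⊗` preserves filtered colimits in each variable. -/
class MonoidallyLFP (W : Type u) [Category.{v} W] [MonoidalCategory W] : Prop
    extends HasColimitsOfSize.{v, v} W where
  lfp : IsLocallyFinitelyPresentable.{v} W
  unit_fp : IsFinitelyPresentable.{v} (𝟙_ W)
  tensor_fp : ∀ A B : W, IsFinitelyPresentable.{v} A → IsFinitelyPresentable.{v} B →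
    IsFinitelyPresentable.{v} (A ⊗ B)
  right_distrib : ∀ Y : W, PreservesFiniteCoproducts (tensorRight Y)
  finitary_left : ∀ Y : W, PreservesFilteredColimits (tensorLeft Y)
  finitary_right : ∀ Y : W, PreservesFilteredColimits (tensorRight Y)

/-! ## Point-strengths

An object of the slice `I / W` is given as an object `X` together with a point `x : 𝟙_ W ⟶ X`;
a morphism of `I / W` is a morphism `f` with `x ≫ f = x'`. -/

section Strength

variable {W : Type u} [Category.{v} W] [MonoidalCategory W]

/-- The point `x ⊗ y` of `X ⊗ Y`. -/
def tensorPoint {X Y : W} (x : 𝟙_ W ⟶ X) (y : 𝟙_ W ⟶ Y) : 𝟙_ W ⟶ X ⊗ Y :=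
  (λ_ (𝟙_ W)).inv ≫ (x ⊗ₘ y)

/-- A collection of morphisms `M X ⊗ Y ⟶ M (X ⊗ Y)`, natural in the pointed objects `(X, x)`
and `(Y, y)`. -/
@[ext]
structure StrengthTransformation (M : W ⥤ W) where
  app : ∀ {X Y : W} (_ : 𝟙_ W ⟶ X) (_ : 𝟙_ W ⟶ Y), M.obj X ⊗ Y ⟶ M.obj (X ⊗ Y)
  naturality : ∀ {X X' Y Y' : W} (x : 𝟙_ W ⟶ X) (x' : 𝟙_ W ⟶ X') (y : 𝟙_ W ⟶ Y)
    (y' : 𝟙_ W ⟶ Y') (f : X ⟶ X') (g : Y ⟶ Y'), x ≫ f = x' → y ≫ g = y' →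
    (M.map f ⊗ₘ g) ≫ app x' y' = app x y ≫ M.map (f ⊗ₘ g)

/-- A point-strength of an endofunctor. In a strict monoidal category the unitors and associators
below are identities. -/
structure PointStrength (M : W ⥤ W) extends StrengthTransformation M where
  unit : ∀ {X : W} (x : 𝟙_ W ⟶ X),
    app x (𝟙 (𝟙_ W)) ≫ M.map (ρ_ X).hom = (ρ_ (M.obj X)).hom
  triangle : ∀ {X Y Z : W} (x : 𝟙_ W ⟶ X) (y : 𝟙_ W ⟶ Y) (z : 𝟙_ W ⟶ Z),
    (α_ (M.obj X) Y Z).hom ≫ app x (tensorPoint y z) ≫ M.map (α_ X Y Z).inv =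
      (app x y ▷ Z) ≫ app (tensorPoint x y) z

/-- A point-strength of a monad: a point-strength of the underlying endofunctor preserving the unit
and the multiplication. A point-strong monad is a monad together with such data. -/
structure MonadPointStrength (M : Monad W) extends PointStrength M.toFunctor where
  preserves_unit : ∀ {X Y : W} (x : 𝟙_ W ⟶ X) (y : 𝟙_ W ⟶ Y),
    (M.η.app X ▷ Y) ≫ app x y = M.η.app (X ⊗ Y)
  preserves_mul : ∀ {X Y : W} (x : 𝟙_ W ⟶ X) (y : 𝟙_ W ⟶ Y),
    (M.μ.app X ▷ Y) ≫ app x y =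
      app (x ≫ M.η.app X) y ≫ M.map (app x y) ≫ M.μ.app (X ⊗ Y)

end Strength

/-! ## Iterative algebras and the rational monad -/

section Iterative

variable {W : Type u} [Category.{v} W] [HasBinaryCoproducts W] {H : W ⥤ W}

/-- `s` is a solution of the flat equation morphism `e : X ⟶ H X + A` in the algebra `A`. -/
def IsSolution (A : Endofunctor.Algebra H) {X : W} (e : X ⟶ H.obj X ⨿ A.a) (s : X ⟶ A.a) : Prop :=
  s = e ≫ coprod.map (H.map s) (𝟙 A.a) ≫ coprod.desc A.str (𝟙 A.a)

/-- An algebra is iterative if every flat equation morphism with a finitely presentable object of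
variables has a unique solution. -/
def IsIterative (A : Endofunctor.Algebra H) : Prop :=
  ∀ (X : W) (e : X ⟶ H.obj X ⨿ A.a), IsFinitelyPresentable.{v} X → ∃! s : X ⟶ A.a, IsSolution A e s

variable (H) in
/-- A free iterative `H`-algebra on `Y`: an iterative algebra with a universal arrow from `Y`, among
all iterative algebras and all algebra homomorphisms. -/
structure FreeIterativeAlgebra (Y : W) where
  alg : Endofunctor.Algebra H
  iterative : IsIterative alg
  η : Y ⟶ alg.a
  universal : ∀ (B : Endofunctor.Algebra H), IsIterative B → ∀ f : Y ⟶ B.a,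
    ∃! h : alg ⟶ B, η ≫ h.f = f

namespace FreeIterativeAlgebra

variable {Y : W} (F : FreeIterativeAlgebra H Y)

/-- The homomorphism extending `f`. -/
noncomputable def lift {B : Endofunctor.Algebra H} (hB : IsIterative B) (f : Y ⟶ B.a) : F.alg ⟶ B :=
  (F.universal B hB f).choose

theorem η_lift {B : Endofunctor.Algebra H} (hB : IsIterative B) (f : Y ⟶ B.a) :
    F.η ≫ (F.lift hB f).f = f :=
  (F.universal B hB f).choose_spec.1

theorem hom_ext {B : Endofunctor.Algebra H} (hB : IsIterative B) {g h : F.alg ⟶ B}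
    (w : F.η ≫ g.f = F.η ≫ h.f) : g = h :=
  (F.universal B hB (F.η ≫ h.f)).unique w rfl

end FreeIterativeAlgebra

/-- The rational monad `(R, η, μ)`: `R Y` is the free iterative algebra on `Y`, the morphism
`R f` is the homomorphism extending `f ≫ η`, and `μ Y : R (R Y) ⟶ R Y` is the homomorphism
extending the identity of `R Y`. -/
noncomputable def rationalMonad (F : ∀ Y : W, FreeIterativeAlgebra H Y) : Monad W where
  obj Y := (F Y).alg.a
  map {_ Z} f := ((F _).lift (F Z).iterative (f ≫ (F Z).η)).f
  map_id Y := by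
    have h := (F Y).hom_ext (F Y).iterative
      (g := (F Y).lift (F Y).iterative (𝟙 Y ≫ (F Y).η)) (h := 𝟙 _)
      (by rw [FreeIterativeAlgebra.η_lift]; simp)
    rw [h]; rfl
  map_comp {X Y Z} f g := by
    have h := (F X).hom_ext (F Z).iterative
      (g := (F X).lift (F Z).iterative ((f ≫ g) ≫ (F Z).η))
      (h := (F X).lift (F Y).iterative (f ≫ (F Y).η) ≫
        (F Y).lift (F Z).iterative (g ≫ (F Z).η))
      (by
        rw [FreeIterativeAlgebra.η_lift, Endofunctor.Algebra.comp_f, ← Category.assoc,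
          FreeIterativeAlgebra.η_lift, Category.assoc, Category.assoc,
          FreeIterativeAlgebra.η_lift])
    rw [h]; rfl
  η :=
    { app := fun Y => (F Y).η
      naturality := fun X Y f => (FreeIterativeAlgebra.η_lift (F X) (F Y).iterative _).symm }
  μ :=
    { app := fun Y => ((F (F Y).alg.a).lift (F Y).iterative (𝟙 (F Y).alg.a)).f
      naturality := fun X Y f => by
        have h := (F (F X).alg.a).hom_ext (F Y).iterative
          (g := (F _).lift (F _).iterative
              (((F X).lift (F Y).iterative (f ≫ (F Y).η)).f ≫ (F (F Y).alg.a).η) ≫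
            (F _).lift (F Y).iterative (𝟙 _))
          (h := (F _).lift (F X).iterative (𝟙 _) ≫ (F X).lift (F Y).iterative (f ≫ (F Y).η))
          (by
            rw [Endofunctor.Algebra.comp_f, Endofunctor.Algebra.comp_f, ← Category.assoc,
              FreeIterativeAlgebra.η_lift, ← Category.assoc, FreeIterativeAlgebra.η_lift,
              Category.assoc, FreeIterativeAlgebra.η_lift, Category.comp_id, Category.id_comp])
        exact congrArg Endofunctor.Algebra.Hom.f h }
  assoc X := by
    have h := (F _).hom_ext (F X).iterative
      (g := (F _).lift (F _).iterative
          (((F (F X).alg.a).lift (F X).iterative (𝟙 (F X).alg.a)).f ≫ (F (F X).alg.a).η) ≫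
        (F _).lift (F X).iterative (𝟙 _))
      (h := (F (F (F X).alg.a).alg.a).lift (F _).iterative (𝟙 _) ≫
        (F _).lift (F X).iterative (𝟙 _))
      (by
        rw [Endofunctor.Algebra.comp_f, Endofunctor.Algebra.comp_f, ← Category.assoc,
          FreeIterativeAlgebra.η_lift, ← Category.assoc, FreeIterativeAlgebra.η_lift,
          Category.assoc, FreeIterativeAlgebra.η_lift, Category.comp_id, Category.id_comp])
    exact congrArg Endofunctor.Algebra.Hom.f h
  left_unit X := FreeIterativeAlgebra.η_lift _ _ _
  right_unit X := by
    have h := (F X).hom_ext (F X).iterative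
      (g := (F _).lift (F _).iterative ((F X).η ≫ (F (F X).alg.a).η) ≫
        (F _).lift (F X).iterative (𝟙 _))
      (h := 𝟙 _)
      (by
        rw [Endofunctor.Algebra.comp_f, ← Category.assoc, FreeIterativeAlgebra.η_lift,
          Category.assoc, FreeIterativeAlgebra.η_lift]
        rfl)
    exact congrArg Endofunctor.Algebra.Hom.f h

/-- The algebra structure `ϱ Y : H (R Y) ⟶ R Y`. -/
def rationalStr (F : ∀ Y : W, FreeIterativeAlgebra H Y) (Y : W) :
    H.obj ((rationalMonad F).obj Y) ⟶ (rationalMonad F).obj Y :=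
  (F Y).alg.str

/-- Compatibility of `s : R X ⊗ Y ⟶ R (X ⊗ Y)` with `ϱ` (via the point-strength of `H`, where `R X`
is pointed by `x ≫ η`) and with `η`. -/
def IsCompatible [MonoidalCategory W] (sH : PointStrength H)
    (F : ∀ Y : W, FreeIterativeAlgebra H Y)
    (s : StrengthTransformation (rationalMonad F).toFunctor) : Prop :=
  ∀ {X Y : W} (x : 𝟙_ W ⟶ X) (y : 𝟙_ W ⟶ Y),
    (rationalStr F X ▷ Y) ≫ s.app x y =
        sH.app (x ≫ (rationalMonad F).η.app X) y ≫ H.map (s.app x y) ≫ rationalStr F (X ⊗ Y) ∧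
    ((rationalMonad F).η.app X ▷ Y) ≫ s.app x y = (rationalMonad F).η.app (X ⊗ Y)

end Iterative

end RationalStrength

/-! The point is that a free iterative algebra `R X` is free with parameters: for `B` iterative and
`g : X ⊗ Y ⟶ B`, exactly one `s : R X ⊗ Y ⟶ B` extends `g` along `η` and commutes with the
structures up to the point-strength of `H` (`FreeIterativeAlgebra.existsUnique_isParamExtension`).
The strength of `R` is the case `g = η` at `X ⊗ Y`. Naturality and every axiom then follow because
both sides are such extensions of the same `g`.

For the existence of `R X`, take the filtered colimit of all coalgebras for `H (-) + X` with
finitely presentable carrier. Its structure map is invertible (`isIso_ratStr`), and `inj E` solves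
`E` read as a system of equations.

For parameters, a pointed coalgebra `E` tensored with `Y` becomes, through the strength of `H`, an
equation `E ⊗ Y ⟶ H (E ⊗ Y) + X ⊗ Y`. It is uniquely solvable in `B` when `E` and `Y` are finitely
presentable; this passes to the colimit in `Y`, then in `E`. The strength needs a point on each `E`:
the point `x` makes the unit object a coalgebra, and the coalgebras under it are cofinal. -/

namespace RationalStrength

/-! ### Finitely presentable objects and filtered colimits. -/

section FinitelyPresentable

attribute [local instance] Cardinal.fact_isRegular_aleph0

variable {C : Type u} [Category.{v} C]

lemma isFinitelyPresentable_initial [HasInitial C] :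
    IsFinitelyPresentable.{v} (⊥_ C) := by
  have : ∀ k, IsCardinalPresentable.{v} ((Functor.empty.{0} C).obj k) Cardinal.aleph0 := by
    rintro ⟨⟨⟩⟩
  exact isCardinalPresentable_of_isColimit.{v} _ (colimit.isColimit (Functor.empty.{0} C)) _
    (hasCardinalLT_of_finite _ _ le_rfl)

lemma isFinitelyPresentable_coprod [HasBinaryCoproducts C] {A B : C}
    (hA : IsFinitelyPresentable.{v} A) (hB : IsFinitelyPresentable.{v} B) :
    IsFinitelyPresentable.{v} (A ⨿ B) := by
  have : ∀ k, IsCardinalPresentable.{v} ((pair A B).obj k) Cardinal.aleph0 := by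
    rintro ⟨_ | _⟩ <;> assumption
  exact isCardinalPresentable_of_isColimit.{v} _ (colimit.isColimit (pair A B)) _
    (hasCardinalLT_of_finite _ _ le_rfl)

lemma isFinitelyPresentable_coequalizer [HasCoequalizers C] {A B : C} (f g : A ⟶ B)
    (hA : IsFinitelyPresentable.{v} A) (hB : IsFinitelyPresentable.{v} B) :
    IsFinitelyPresentable.{v} (coequalizer f g) := by
  have : ∀ k, IsCardinalPresentable.{v} ((parallelPair f g).obj k) Cardinal.aleph0 := by
    rintro (_ | _) <;> assumption
  exact isCardinalPresentable_of_isColimit.{v} _ (colimit.isColimit (parallelPair f g)) _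
    (hasCardinalLT_of_finite _ _ le_rfl)

lemma exists_filtered_presentation [IsLocallyFinitelyPresentable.{v} C] (X : C) :
    ∃ (J : Type v) (_ : SmallCategory J) (_ : IsFiltered J) (p : ColimitPresentation J X),
      ∀ j, IsFinitelyPresentable.{v} (p.diag.obj j) := by
  obtain ⟨P, _, hP⟩ := HasCardinalFilteredGenerator.exists_generator C Cardinal.aleph0.{v}
  obtain ⟨J, _, hJ, ⟨p⟩⟩ := hP.exists_colimitsOfShape X
  exact ⟨J, inferInstance, (isCardinalFiltered_aleph0_iff J).1 hJ, p.toColimitPresentation,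
    fun j ↦ hP.le_isCardinalPresentable _ (p.prop_diag_obj j)⟩

/-- The finitely presentable objects contain a strong generator: it separates, so `r` is mono, and a
mono through which all maps from a strong generator factor is invertible. -/
lemma isIso_of_isFinitelyPresentable [IsLocallyFinitelyPresentable.{v} C] {X Y : C} (r : X ⟶ Y)
    (inj : ∀ (P : C), IsFinitelyPresentable.{v} P → ∀ a b : P ⟶ X, a ≫ r = b ≫ r → a = b)
    (surj : ∀ (P : C), IsFinitelyPresentable.{v} P → ∀ g : P ⟶ Y, ∃ f : P ⟶ X, f ≫ r = g) :
    IsIso r := by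
  obtain ⟨P, _, hP⟩ := HasCardinalFilteredGenerator.exists_generator C Cardinal.aleph0.{v}
  have : Mono r := ⟨fun a b h ↦ hP.isStrongGenerator.isSeparating _ _ fun G hG k ↦
    inj G (hP.le_isCardinalPresentable _ hG) _ _ (by simp [h])⟩
  exact hP.isStrongGenerator.isIso_of_mono r fun G hG ↦ surj G (hP.le_isCardinalPresentable _ hG)

lemma preservesColimitsOfShape_of_essentiallySmall {D : Type*} [Category.{v} D] (F : C ⥤ D)
    [PreservesFilteredColimits F] (J : Type*) [Category* J] [EssentiallySmall.{v} J]
    [IsFiltered J] : PreservesColimitsOfShape J F := by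
  have := IsFiltered.of_equivalence (equivSmallModel.{v} J)
  exact preservesColimitsOfShape_of_equiv (equivSmallModel.{v} J).symm F

lemma exists_hom_of_isColimit {J : Type*} [Category* J] [EssentiallySmall.{v} J] [IsFiltered J]
    {D : J ⥤ C} {c : Cocone D} (hc : IsColimit c) {X : C} (hX : IsFinitelyPresentable.{v} X)
    (f : X ⟶ c.pt) : ∃ (j : J) (p : X ⟶ D.obj j), p ≫ c.ι.app j = f := by
  have := (isCardinalFiltered_aleph0_iff.{v} J).2 inferInstance
  exact IsCardinalPresentable.exists_hom_of_isColimit Cardinal.aleph0.{v} hc f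

lemma exists_eq_of_isColimit {J : Type*} [Category* J] [EssentiallySmall.{v} J] [IsFiltered J]
    {D : J ⥤ C} {c : Cocone D} (hc : IsColimit c) {X : C} (hX : IsFinitelyPresentable.{v} X)
    {j : J} (f g : X ⟶ D.obj j) (h : f ≫ c.ι.app j = g ≫ c.ι.app j) :
    ∃ (k : J) (a : j ⟶ k), f ≫ D.map a = g ≫ D.map a := by
  have := (isCardinalFiltered_aleph0_iff.{v} J).2 inferInstance
  exact IsCardinalPresentable.exists_eq_of_isColimit' Cardinal.aleph0.{v} hc f g h

end FinitelyPresentable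

/-! ### The functor `H (-) + X` is finitary. -/

section AddConst

variable {C : Type u} [Category.{v} C] [HasBinaryCoproducts C]

/-- The endofunctor `H (-) + X`. -/
noncomputable abbrev addConst (H : C ⥤ C) (X : C) : C ⥤ C where
  obj Z := H.obj Z ⨿ X
  map f := coprod.map (H.map f) (𝟙 X)

/-- A filtered category is connected, so the constant summand `X` contributes a single morphism to
any cocone. -/
lemma inr_const_of_isFiltered {J : Type*} [Category* J] [IsFiltered J] {H : C ⥤ C} {X : C}
    {D : J ⥤ C} (s : Cocone (D ⋙ addConst H X)) (i j : J) :
    (coprod.inr : X ⟶ H.obj (D.obj i) ⨿ X) ≫ s.ι.app i =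
      (coprod.inr : X ⟶ H.obj (D.obj j) ⨿ X) ≫ s.ι.app j := by
  rw [← s.w (IsFiltered.leftToMax i j), ← s.w (IsFiltered.rightToMax i j)]
  simp

instance (H : C ⥤ C) [PreservesFilteredColimits H] (X : C) :
    PreservesFilteredColimits (addConst H X) where
  preserves_filtered_colimits J _ _ := ⟨fun {D} ↦ ⟨fun {c} hc ↦ ⟨by
    have hH := isColimitOfPreserves H hc
    let j₀ : J := IsFiltered.nonempty.some
    let left (s : Cocone (D ⋙ addConst H X)) : Cocone (D ⋙ H) :=
      { pt := s.pt
        ι := { app j := coprod.inl ≫ s.ι.app j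
               naturality i j f := by
                have := s.w f
                dsimp at this ⊢
                simp [← this] } }
    let l (s : Cocone (D ⋙ addConst H X)) : H.obj c.pt ⟶ s.pt := hH.desc (left s)
    have hl (s : Cocone (D ⋙ addConst H X)) (j : J) :
        H.map (c.ι.app j) ≫ l s = coprod.inl ≫ s.ι.app j := hH.fac (left s) j
    let d (s : Cocone (D ⋙ addConst H X)) : H.obj c.pt ⨿ X ⟶ s.pt :=
      coprod.desc (l s) (coprod.inr ≫ s.ι.app j₀)
    exact
      { desc := d
        fac s j := by
          change coprod.map (H.map (c.ι.app j)) (𝟙 X) ≫ d s = _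
          rw [coprod.map_desc, hl, Category.id_comp, inr_const_of_isFiltered s j₀ j]
          exact coprod.hom_ext (coprod.inl_desc _ _) (coprod.inr_desc _ _)
        uniq s m hm := by
          change H.obj c.pt ⨿ X ⟶ s.pt at m
          replace hm (j : J) : coprod.map (H.map (c.ι.app j)) (𝟙 X) ≫ m = s.ι.app j := hm j
          refine coprod.hom_ext ?_ ?_
          · refine hH.hom_ext fun j ↦ ?_
            change H.map (c.ι.app j) ≫ coprod.inl ≫ m = H.map (c.ι.app j) ≫ coprod.inl ≫ d s
            rw [coprod.inl_desc, hl, ← hm, coprod.inl_map_assoc]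
          · rw [coprod.inr_desc, ← hm, coprod.inr_map_assoc, Category.id_comp]
            rfl }⟩⟩⟩

end AddConst

/-! ### The rational fixpoint of a finitary functor. -/

section RationalFixpoint

open Endofunctor

variable {C : Type u} [Category.{v} C]

/-- The coalgebras with a finitely presentable carrier. -/
abbrev fpCoalgebra (G : C ⥤ C) : ObjectProperty (Coalgebra G) :=
  fun E ↦ IsFinitelyPresentable.{v} E.V

/-- The category of coalgebras with a finitely presentable carrier. -/
abbrev FpCoalgebra (G : C ⥤ C) := (fpCoalgebra G).FullSubcategory

namespace FpCoalgebra

/-- The forgetful functor from coalgebras with a finitely presentable carrier. -/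
abbrev forget (G : C ⥤ C) : FpCoalgebra G ⥤ C := (fpCoalgebra G).ι ⋙ Coalgebra.forget G

/-- A coalgebra homomorphism between coalgebras with finitely presentable carriers. -/
abbrev homMk {G : C ⥤ C} {E E' : FpCoalgebra G} (f : E.obj.V ⟶ E'.obj.V)
    (h : E.obj.str ≫ G.map f = f ≫ E'.obj.str) : E ⟶ E' :=
  ObjectProperty.homMk { f := f, h := h }

variable [IsLocallyFinitelyPresentable.{v} C] (G : C ⥤ C)

instance : LocallySmall.{v} (FpCoalgebra G) :=
  locallySmall_of_faithful (forget G)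

/-- Up to isomorphism there is only a small set of finitely presentable carriers, each with a small
set of structures; a structure is transported along an isomorphism of carriers. -/
instance : EssentiallySmall.{v} (FpCoalgebra G) := by
  let := Cardinal.fact_isRegular_aleph0.{v}
  obtain ⟨Q, _, hQ, hQ'⟩ := ObjectProperty.EssentiallySmall.exists_small_le.{v}
    (isCardinalPresentable C Cardinal.aleph0.{v})
  let φ : (Σ A : Subtype Q, A.1 ⟶ G.obj A.1) → FpCoalgebra G :=
    fun A ↦ ⟨⟨A.1.1, A.2⟩, hQ _ A.1.2⟩
  rw [essentiallySmall_iff]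
  refine ⟨small_of_surjective (f := fun A ↦ toSkeleton (φ A)) fun E ↦ ?_, inferInstance⟩
  obtain ⟨E, rfl⟩ := Quotient.exists_rep E
  obtain ⟨A, hA, ⟨i⟩⟩ := hQ' _ E.property
  let e : Endofunctor.Coalgebra.mk A (i.inv ≫ E.obj.str ≫ G.map i.hom) ≅ E.obj :=
    Endofunctor.Coalgebra.isoMk i.symm (by simp [← Functor.map_comp])
  refine ⟨⟨⟨A, hA⟩, i.inv ≫ E.obj.str ≫ G.map i.hom⟩, ?_⟩
  exact Quotient.sound ⟨(fpCoalgebra G).isoMk e⟩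

/-- Finite colimits of coalgebras are formed on carriers, where they preserve finite presentability.
-/
instance : IsFiltered (FpCoalgebra G) where
  nonempty := ⟨⟨⟨⊥_ C, initial.to _⟩, isFinitelyPresentable_initial⟩⟩
  cocone_objs E E' :=
    ⟨⟨⟨E.obj.V ⨿ E'.obj.V, coprod.desc (E.obj.str ≫ G.map coprod.inl)
        (E'.obj.str ≫ G.map coprod.inr)⟩,
        isFinitelyPresentable_coprod E.property E'.property⟩,
      homMk coprod.inl (coprod.inl_desc _ _).symm, homMk coprod.inr (coprod.inr_desc _ _).symm,
      trivial⟩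
  cocone_maps E E' f g :=
    ⟨⟨⟨coequalizer f.hom.f g.hom.f,
        coequalizer.desc (E'.obj.str ≫ G.map (coequalizer.π _ _)) (by
          rw [← f.hom.h_assoc, ← g.hom.h_assoc, ← G.map_comp, ← G.map_comp,
            coequalizer.condition])⟩,
        isFinitelyPresentable_coequalizer _ _ E.property E'.property⟩,
      homMk (coequalizer.π _ _) (by simp), by
        ext
        exact coequalizer.condition _ _⟩

instance : HasColimit (forget G) :=
  have := hasColimitsOfShape_of_equivalence (C := C) (equivSmallModel.{v} (FpCoalgebra G)).symm
  inferInstance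

/-- The rational fixpoint, as the colimit of all coalgebras with a finitely presentable carrier. -/
noncomputable def ratFix : C := colimit (forget G)

variable {G}

/-- The colimit injections of the rational fixpoint. -/
noncomputable def inj (E : FpCoalgebra G) : E.obj.V ⟶ ratFix G := colimit.ι (forget G) E

lemma w {E E' : FpCoalgebra G} (h : E ⟶ E') : h.hom.f ≫ inj E' = inj E :=
  colimit.w (forget G) h

variable (G) in
/-- The colimit cocone defining the rational fixpoint. -/
@[simps]
noncomputable def cocone : Cocone (forget G) where
  pt := ratFix G
  ι := { app := inj
         naturality _ _ h := (w h).trans (Category.comp_id _).symm }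

variable (G) in
/-- The rational fixpoint is a colimit. -/
noncomputable def isColimitCocone : IsColimit (cocone G) := colimit.isColimit (forget G)

lemma hom_ext {A : C} {f g : ratFix G ⟶ A} (h : ∀ E, inj E ≫ f = inj E ≫ g) : f = g :=
  (isColimitCocone G).hom_ext h

variable (G) in
/-- The coalgebra structure of the rational fixpoint. -/
noncomputable def ratStr : ratFix G ⟶ G.obj (ratFix G) :=
  (isColimitCocone G).desc
    { pt := _
      ι := { app E := E.obj.str ≫ G.map (inj E)
             naturality E E' h := by
              refine Eq.trans ?_ (Category.comp_id _).symm
              change h.hom.f ≫ E'.obj.str ≫ G.map (inj E') = E.obj.str ≫ G.map (inj E)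
              rw [← w h, G.map_comp, h.hom.h_assoc] } }

@[simp]
lemma inj_ratStr (E : FpCoalgebra G) : inj E ≫ ratStr G = E.obj.str ≫ G.map (inj E) :=
  (isColimitCocone G).fac _ E

lemma exists_factor {P : C} (hP : IsFinitelyPresentable.{v} P) (f : P ⟶ ratFix G) :
    ∃ (E : FpCoalgebra G) (p : P ⟶ E.obj.V), p ≫ inj E = f :=
  exists_hom_of_isColimit (isColimitCocone G) hP f

variable [PreservesFilteredColimits G]

instance : PreservesColimit (forget G) G :=
  have := preservesColimitsOfShape_of_essentiallySmall G (FpCoalgebra G)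
  inferInstance

lemma exists_map_factor {P : C} (hP : IsFinitelyPresentable.{v} P) (f : P ⟶ G.obj (ratFix G)) :
    ∃ (E : FpCoalgebra G) (p : P ⟶ G.obj E.obj.V), p ≫ G.map (inj E) = f :=
  exists_hom_of_isColimit (isColimitOfPreserves G (isColimitCocone G)) hP f

lemma exists_map_eq {P : C} (hP : IsFinitelyPresentable.{v} P) {E : FpCoalgebra G}
    (f g : P ⟶ G.obj E.obj.V) (h : f ≫ G.map (inj E) = g ≫ G.map (inj E)) :
    ∃ (E' : FpCoalgebra G) (k : E ⟶ E'), f ≫ G.map k.hom.f = g ≫ G.map k.hom.f :=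
  exists_eq_of_isColimit (isColimitOfPreserves G (isColimitCocone G)) hP f g h

instance isIso_ratStr : IsIso (ratStr G) := by
  refine isIso_of_isFinitelyPresentable _ (fun P hP a b hab ↦ ?_) fun P hP g ↦ ?_
  · obtain ⟨Ea, a, rfl⟩ := exists_factor hP a
    obtain ⟨Eb, b, rfl⟩ := exists_factor hP b
    obtain ⟨E, ka, kb, -⟩ := IsFilteredOrEmpty.cocone_objs Ea Eb
    rw [← w ka, ← w kb, ← Category.assoc, ← Category.assoc] at hab ⊢
    generalize a ≫ ka.hom.f = a at *
    generalize b ≫ kb.hom.f = b at *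
    simp only [Category.assoc, inj_ratStr] at hab
    simp only [← Category.assoc] at hab
    obtain ⟨E', k, hk⟩ := exists_map_eq hP _ _ hab
    simp only [Category.assoc, k.hom.h] at hk
    -- The two maps already agree after the structure of `E'`, so their coequalizer inherits a
    -- coalgebra structure. Being a quotient of `E'` in the diagram, it identifies them in the
    -- colimit.
    let Q : FpCoalgebra G := ⟨⟨coequalizer (a ≫ k.hom.f) (b ≫ k.hom.f),
      coequalizer.desc (E'.obj.str ≫ G.map (coequalizer.π _ _)) (by
        simp only [Category.assoc]
        rw [reassoc_of% hk])⟩, isFinitelyPresentable_coequalizer _ _ hP E'.property⟩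
    let q : E' ⟶ Q := homMk (coequalizer.π _ _) (by simp [Q])
    have hq : a ≫ k.hom.f ≫ q.hom.f = b ≫ k.hom.f ≫ q.hom.f := by
      rw [← Category.assoc, ← Category.assoc]
      exact coequalizer.condition (a ≫ k.hom.f) (b ≫ k.hom.f)
    rw [← w k, ← w q, reassoc_of% hq]
  · obtain ⟨E, p, rfl⟩ := exists_map_factor hP g
    -- Adjoining `P` to `E` as new states with transitions `p` yields a coalgebra whose injection,
    -- restricted to `P`, is the required preimage.
    let E' : FpCoalgebra G := ⟨⟨P ⨿ E.obj.V,
      coprod.desc (p ≫ G.map coprod.inr) (E.obj.str ≫ G.map coprod.inr)⟩,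
      isFinitelyPresentable_coprod hP E.property⟩
    let k : E ⟶ E' := homMk coprod.inr (coprod.inr_desc _ _).symm
    refine ⟨(coprod.inl : P ⟶ P ⨿ E.obj.V) ≫ inj E', ?_⟩
    have hE : (coprod.inl : P ⟶ P ⨿ E.obj.V) ≫ E'.obj.str = p ≫ G.map k.hom.f :=
      coprod.inl_desc _ _
    rw [Category.assoc, inj_ratStr, ← w k, G.map_comp, reassoc_of% hE]

/-- The injections are the only coalgebra homomorphisms into the rational fixpoint. -/
lemma eq_inj {E : FpCoalgebra G} (f : E.obj.V ⟶ ratFix G)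
    (hf : E.obj.str ≫ G.map f = f ≫ ratStr G) : f = inj E := by
  obtain ⟨E', f, rfl⟩ := exists_factor E.property f
  rw [Category.assoc, inj_ratStr, G.map_comp, ← Category.assoc, ← Category.assoc] at hf
  obtain ⟨E'', k, hk⟩ := exists_map_eq E.property _ _ hf
  -- The homomorphism condition, true in the colimit, already holds at the stage `E''`.
  let h : E ⟶ E'' := homMk (f ≫ k.hom.f) (by simpa using hk)
  rw [← w k, ← w h, ← Category.assoc]
  rfl

end FpCoalgebra

end RationalFixpoint

/-! ### The rational fixpoint as a free iterative algebra. -/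

section FreeIterative

attribute [local simp] coprod.inl_desc coprod.inr_desc coprod.inl_desc_assoc coprod.inr_desc_assoc

open Endofunctor FpCoalgebra

variable {C : Type u} [Category.{v} C]

lemma IsIterative.existsUnique [HasBinaryCoproducts C] {H : C ⥤ C} {B : Algebra H}
    (hB : IsIterative B) {Z X : C} (hZ : IsFinitelyPresentable.{v} Z) (e : Z ⟶ H.obj Z ⨿ X)
    (f : X ⟶ B.a) : ∃! s : Z ⟶ B.a, s = e ≫ coprod.desc (H.map s ≫ B.str) f := by
  simpa [IsSolution] using hB Z (e ≫ coprod.map (𝟙 _) f) hZ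

variable [IsLocallyFinitelyPresentable.{v} C]

/-- `A ⨿ ratFix G` is the filtered colimit of the objects `A ⨿ E`. The braiding is needed only
because `addConst` keeps its constant on the right. -/
lemma exists_coprod_factor {G : C ⥤ C} {Z A : C} (hZ : IsFinitelyPresentable.{v} Z)
    (e : Z ⟶ A ⨿ ratFix G) :
    ∃ (E : FpCoalgebra G) (e₀ : Z ⟶ A ⨿ E.obj.V), e₀ ≫ coprod.map (𝟙 A) (inj E) = e := by
  have : PreservesFilteredColimits (𝟭 C) := ⟨fun _ ↦ inferInstance⟩
  have := preservesColimitsOfShape_of_essentiallySmall (addConst (𝟭 C) A) (FpCoalgebra G)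
  obtain ⟨E, e₀, he⟩ := exists_hom_of_isColimit
    (isColimitOfPreserves (addConst (𝟭 C) A) (isColimitCocone G)) hZ
    (e ≫ (coprod.braiding A (ratFix G)).hom)
  change Z ⟶ E.obj.V ⨿ A at e₀
  replace he : e₀ ≫ coprod.map (inj E) (𝟙 A) = e ≫ (coprod.braiding A (ratFix G)).hom := he
  refine ⟨E, e₀ ≫ (coprod.braiding E.obj.V A).hom, ?_⟩
  rw [← cancel_mono (coprod.braiding A (ratFix G)).hom, ← he]
  have : (coprod.braiding E.obj.V A).hom ≫ coprod.map (𝟙 A) (inj E) ≫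
      (coprod.braiding A (ratFix G)).hom = coprod.map (inj E) (𝟙 A) := by
    ext <;> simp
  simp only [Category.assoc, this]

variable (H : C ⥤ C) [PreservesFilteredColimits H] (X : C)

/-- The rational fixpoint of `H (-) + X`, as an algebra for `H`. -/
noncomputable abbrev ratAlgebra : Algebra H where
  a := ratFix (addConst H X)
  str := coprod.inl ≫ inv (ratStr (addConst H X))

/-- The morphism from `X` to the rational fixpoint of `H (-) + X`. -/
noncomputable abbrev ratUnit : X ⟶ ratFix (addConst H X) :=
  coprod.inr ≫ inv (ratStr (addConst H X))

lemma desc_ratAlgebra_str :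
    coprod.desc (ratAlgebra H X).str (ratUnit H X) = inv (ratStr (addConst H X)) := by
  ext <;> simp

variable {H X}

lemma inj_eq_comp_desc (E : FpCoalgebra (addConst H X)) :
    inj E = E.obj.str ≫ coprod.desc (H.map (inj E) ≫ (ratAlgebra H X).str) (ratUnit H X) := by
  have := (IsIso.eq_comp_inv _).2 (inj_ratStr E)
  rw [← desc_ratAlgebra_str, Category.assoc, coprod.map_desc, Category.id_comp] at this
  exact this

lemma isIterative_ratAlgebra : IsIterative (ratAlgebra H X) := by
  intro Z e hZ
  obtain ⟨E, e₀, rfl⟩ := exists_coprod_factor hZ e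
  -- The equation and its finitely presentable parameters `E` merge into one coalgebra on `Z ⨿ E`,
  -- parameters being unfolded once by the structure of `E`. Solutions `s` then correspond to
  -- homomorphisms `[s, inj E]` into the fixpoint, and `eq_inj` leaves only one.
  let E' : FpCoalgebra (addConst H X) := ⟨⟨Z ⨿ E.obj.V,
    coprod.desc (e₀ ≫ coprod.desc (H.map coprod.inl ≫ coprod.inl)
      (E.obj.str ≫ coprod.map (H.map coprod.inr) (𝟙 X)))
      (E.obj.str ≫ coprod.map (H.map coprod.inr) (𝟙 X))⟩,
    isFinitelyPresentable_coprod hZ E.property⟩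
  let k : E ⟶ E' := homMk coprod.inr (coprod.inr_desc _ _).symm
  have hk : (coprod.inr : E.obj.V ⟶ Z ⨿ E.obj.V) ≫ inj E' = inj E := w k
  have hZ' : (coprod.inl : Z ⟶ Z ⨿ E.obj.V) ≫ E'.obj.str =
    e₀ ≫ coprod.desc (H.map coprod.inl ≫ coprod.inl)
      (E.obj.str ≫ coprod.map (H.map coprod.inr) (𝟙 X)) := coprod.inl_desc _ _
  have hE' : (coprod.inr : E.obj.V ⟶ Z ⨿ E.obj.V) ≫ E'.obj.str =
    E.obj.str ≫ coprod.map (H.map coprod.inr) (𝟙 X) := coprod.inr_desc _ _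
  have key (f : Z ⨿ E.obj.V ⟶ ratFix (addConst H X)) (hf : coprod.inr ≫ f = inj E) :
      coprod.inl ≫ E'.obj.str ≫ coprod.map (H.map f) (𝟙 X) =
        e₀ ≫ coprod.desc (H.map (coprod.inl ≫ f) ≫ coprod.inl)
          (inj E ≫ ratStr (addConst H X)) := by
    rw [reassoc_of% hZ', inj_ratStr]
    congr 1
    ext
    · simp
    · simp [← hf]
  have sol (s : Z ⟶ ratFix (addConst H X)) :
      IsSolution (ratAlgebra H X) (e₀ ≫ coprod.map (𝟙 _) (inj E)) s ↔
      s ≫ ratStr (addConst H X) =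
        e₀ ≫ coprod.desc (H.map s ≫ coprod.inl) (inj E ≫ ratStr (addConst H X)) := by
    rw [IsSolution, ← cancel_mono (ratStr (addConst H X))]
    simp
  refine ⟨coprod.inl ≫ inj E', ?_, fun s hs ↦ ?_⟩
  · beta_reduce
    rw [sol, Category.assoc, inj_ratStr, ← key _ hk]
  · replace hs := (sol s).1 hs
    have : coprod.desc s (inj E) = inj E' := by
      refine eq_inj (E := E') _ ?_
      refine coprod.hom_ext ?_ ?_
      · refine (key _ (coprod.inr_desc _ _)).trans ?_
        rw [coprod.inl_desc, ← hs, coprod.inl_desc_assoc]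
      · change coprod.inr ≫ E'.obj.str ≫ coprod.map (H.map (coprod.desc s (inj E))) (𝟙 X) =
          coprod.inr ≫ coprod.desc s (inj E) ≫ ratStr (addConst H X)
        rw [reassoc_of% hE', coprod.inr_desc_assoc, inj_ratStr, coprod.map_map, ← H.map_comp,
          coprod.inr_desc, Category.comp_id]
    rw [← this, coprod.inl_desc]

lemma ratAlgebra_universal (B : Algebra H) (hB : IsIterative B) (f : X ⟶ B.a) :
    ∃! h : ratAlgebra H X ⟶ B, ratUnit H X ≫ h.f = f := by
  -- A homomorphism extending `f` amounts to a family of solutions in `B` of all coalgebras `E`;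
  -- uniqueness of solutions makes this family a cocone.
  choose sol hsol hsol' using fun E : FpCoalgebra (addConst H X) ↦
    hB.existsUnique E.property E.obj.str f
  have hw {E E' : FpCoalgebra (addConst H X)} (k : E ⟶ E') : k.hom.f ≫ sol E' = sol E := by
    refine hsol' E _ ?_
    beta_reduce at hsol ⊢
    conv_lhs => rw [hsol E', ← k.hom.h_assoc]
    dsimp only [addConst]
    rw [coprod.map_desc, Category.id_comp, H.map_comp, Category.assoc]
  let c : Cocone (forget (addConst H X)) :=
    { pt := B.a
      ι := { app := sol
             naturality _ _ k := (hw k).trans (Category.comp_id _).symm } }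
  let u : ratFix (addConst H X) ⟶ B.a := (isColimitCocone _).desc c
  have hu (E) : inj E ≫ u = sol E := (isColimitCocone _).fac c E
  have hu' : inv (ratStr (addConst H X)) ≫ u = coprod.desc (H.map u ≫ B.str) f := by
    rw [IsIso.inv_comp_eq]
    refine hom_ext fun E ↦ ?_
    rw [hu, reassoc_of% (inj_ratStr E), hsol E, ← hu]
    simp
  refine ⟨⟨u, ?_⟩, ?_, fun h hh ↦ ?_⟩
  · simp [hu']
  · simp [hu']
  · ext
    refine hom_ext fun E ↦ ?_
    rw [hu]
    refine hsol' E _ ?_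
    change inj E ≫ h.f = _
    conv_lhs => rw [inj_eq_comp_desc, Category.assoc, coprod.desc_comp, hh]
    have hstr : coprod.inl ≫ inv (ratStr (addConst H X)) ≫ h.f = H.map h.f ≫ B.str :=
      (Category.assoc _ _ _).symm.trans h.h.symm
    simp only [H.map_comp, Category.assoc, hstr]

variable (H X) in
/-- The rational fixpoint of `H (-) + X` is a free iterative algebra on `X`. -/
noncomputable def ratFreeIterativeAlgebra : FreeIterativeAlgebra H X where
  alg := ratAlgebra H X
  iterative := isIterative_ratAlgebra
  η := ratUnit H X
  universal := ratAlgebra_universal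

end FreeIterative

/-! ### Filtered colimits computed over a coslice. -/

section FinalUnder

lemma hom_ext_of_under {J C : Type*} [Category* J] [Category* C] [IsFiltered J] {F : J ⥤ C}
    {c : Cocone F} (hc : IsColimit c) (j₀ : J) {Z : C} {f g : c.pt ⟶ Z}
    (h : ∀ i : Under j₀, c.ι.app i.right ≫ f = c.ι.app i.right ≫ g) : f = g :=
  ((Functor.Final.isColimitWhiskerEquiv (Under.forget j₀) c).symm hc).hom_ext h

lemma exists_desc_of_under {J C : Type*} [Category* J] [Category* C] [IsFiltered J] {F : J ⥤ C}
    {c : Cocone F} (hc : IsColimit c) (j₀ : J) {Z : C} (t : ∀ i : Under j₀, F.obj i.right ⟶ Z)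
    (ht : ∀ {i i' : Under j₀} (a : i ⟶ i'), F.map a.right ≫ t i' = t i) :
    ∃ s : c.pt ⟶ Z, ∀ i : Under j₀, c.ι.app i.right ≫ s = t i := by
  let d : Cocone (Under.forget j₀ ⋙ F) :=
    { pt := Z
      ι := { app := t
             naturality _ _ a := (ht a).trans (Category.comp_id _).symm } }
  let hc' := (Functor.Final.isColimitWhiskerEquiv (Under.forget j₀) c).symm hc
  exact ⟨hc'.desc d, hc'.fac d⟩

end FinalUnder

/-! ### Unique solvability of equations with parameters. -/

section TensorSolution

open Endofunctor

variable {W : Type u} [Category.{v} W] [MonoidalCategory W] [MonoidallyLFP W]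

instance : IsLocallyFinitelyPresentable.{v} W := MonoidallyLFP.lfp

instance (Y : W) : PreservesFiniteCoproducts (tensorRight Y) := MonoidallyLFP.right_distrib Y

instance (Y : W) : PreservesFilteredColimits (tensorRight Y) := MonoidallyLFP.finitary_right Y

instance (Y : W) : PreservesFilteredColimits (tensorLeft Y) := MonoidallyLFP.finitary_left Y

/-- The copairing of two morphisms out of a tensor product with a coproduct on the left. -/
noncomputable def rdesc {A B Y Z : W} (f : A ⊗ Y ⟶ Z) (g : B ⊗ Y ⟶ Z) : (A ⨿ B) ⊗ Y ⟶ Z :=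
  (isColimitOfHasBinaryCoproductOfPreservesColimit (tensorRight Y) A B).desc (BinaryCofan.mk f g)

lemma inl_rdesc {A B Y Z : W} (f : A ⊗ Y ⟶ Z) (g : B ⊗ Y ⟶ Z) :
    (coprod.inl ▷ Y) ≫ rdesc f g = f :=
  (isColimitOfHasBinaryCoproductOfPreservesColimit (tensorRight Y) A B).fac _ ⟨.left⟩

lemma inr_rdesc {A B Y Z : W} (f : A ⊗ Y ⟶ Z) (g : B ⊗ Y ⟶ Z) :
    (coprod.inr ▷ Y) ≫ rdesc f g = g :=
  (isColimitOfHasBinaryCoproductOfPreservesColimit (tensorRight Y) A B).fac _ ⟨.right⟩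

lemma coprod_tensor_hom_ext {A B Y Z : W} {f g : (A ⨿ B) ⊗ Y ⟶ Z}
    (hl : (coprod.inl ▷ Y) ≫ f = (coprod.inl ▷ Y) ≫ g)
    (hr : (coprod.inr ▷ Y) ≫ f = (coprod.inr ▷ Y) ≫ g) : f = g :=
  BinaryCofan.IsColimit.hom_ext
    (isColimitOfHasBinaryCoproductOfPreservesColimit (tensorRight Y) A B) hl hr

lemma rdesc_comp {A B Y Z Z' : W} (f : A ⊗ Y ⟶ Z) (g : B ⊗ Y ⟶ Z) (k : Z ⟶ Z') :
    rdesc f g ≫ k = rdesc (f ≫ k) (g ≫ k) :=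
  coprod_tensor_hom_ext (by rw [← Category.assoc, inl_rdesc, inl_rdesc])
    (by rw [← Category.assoc, inr_rdesc, inr_rdesc])

lemma map_tensor_rdesc {A A' B Y Y' Z : W} (a : A ⟶ A') (k : Y ⟶ Y') (f : A' ⊗ Y' ⟶ Z)
    (g : B ⊗ Y' ⟶ Z) :
    (coprod.map a (𝟙 B) ⊗ₘ k) ≫ rdesc f g = rdesc ((a ⊗ₘ k) ≫ f) ((B ◁ k) ≫ g) := by
  refine coprod_tensor_hom_ext ?_ ?_
  · rw [inl_rdesc, tensorHom_def_assoc, ← comp_whiskerRight_assoc, coprod.inl_map,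
      comp_whiskerRight_assoc, ← whisker_exchange_assoc, inl_rdesc, tensorHom_def_assoc]
  · rw [inr_rdesc, tensorHom_def_assoc, ← comp_whiskerRight_assoc, coprod.inr_map,
      Category.id_comp, ← whisker_exchange_assoc, inr_rdesc]

/-- A point of `X`, as a coalgebra for `H (-) + X` carried by the unit object. -/
noncomputable abbrev unitCoalgebra (H : W ⥤ W) {X : W} (x : 𝟙_ W ⟶ X) :
    Coalgebra (addConst H X) where
  V := 𝟙_ W
  str := x ≫ coprod.inr

variable {H : W ⥤ W} (sH : PointStrength H) (B : Algebra H) {X : W} {x : 𝟙_ W ⟶ X}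

/-- Solutions `E ⊗ Y ⟶ B` of a pointed coalgebra `E` for `H (-) + X`, where the point-strength of
`H` distributes the parameters `Y` and the parameters in `X ⊗ Y` are interpreted by `g`. -/
def IsTensorSolution {E : Coalgebra (addConst H X)} (p : unitCoalgebra H x ⟶ E) {Y : W}
    (y : 𝟙_ W ⟶ Y) (g : X ⊗ Y ⟶ B.a) (s : E.V ⊗ Y ⟶ B.a) : Prop :=
  s = (E.str ▷ Y) ≫ rdesc (sH.app p.f y ≫ H.map s ≫ B.str) g

/-- Every interpretation of the parameters has a unique solution. -/
def UniquelySolvable {E : Coalgebra (addConst H X)} (p : unitCoalgebra H x ⟶ E) {Y : W}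
    (y : 𝟙_ W ⟶ Y) : Prop :=
  ∀ g : X ⊗ Y ⟶ B.a, ∃! s, IsTensorSolution sH B p y g s

variable {sH B}

lemma coalgebraHom_tensor_str {E E' : Coalgebra (addConst H X)} {Y Y' : W} (h : E ⟶ E')
    (k : Y ⟶ Y') :
    (h.f ⊗ₘ k) ≫ (E'.str ▷ Y') = (E.str ▷ Y) ≫ (coprod.map (H.map h.f) (𝟙 X) ⊗ₘ k) := by
  rw [← tensorHom_id, ← tensorHom_id, tensorHom_comp_tensorHom, tensorHom_comp_tensorHom,
    ← h.h, Category.id_comp, Category.comp_id]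

lemma IsTensorSolution.precomp {E E' : Coalgebra (addConst H X)} {p : unitCoalgebra H x ⟶ E}
    {p' : unitCoalgebra H x ⟶ E'} {Y Y' : W} {y : 𝟙_ W ⟶ Y} {y' : 𝟙_ W ⟶ Y'}
    {g : X ⊗ Y' ⟶ B.a} {s : E'.V ⊗ Y' ⟶ B.a} (hs : IsTensorSolution sH B p' y' g s)
    (h : E ⟶ E') (k : Y ⟶ Y') (hp : p ≫ h = p') (hy : y ≫ k = y') :
    IsTensorSolution sH B p y ((X ◁ k) ≫ g) ((h.f ⊗ₘ k) ≫ s) := by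
  have hE := coalgebraHom_tensor_str h k
  have hn := sH.naturality p.f p'.f y y' h.f k (congrArg Coalgebra.Hom.f hp) hy
  unfold IsTensorSolution at hs ⊢
  conv_lhs => rw [hs, reassoc_of% hE, map_tensor_rdesc, reassoc_of% hn]
  rw [H.map_comp, Category.assoc]

/-- Since `E ⊗ Y` is finitely presentable, a tensor solution is a solution of an ordinary flat
equation with variables `E ⊗ Y` and parameters `X ⊗ Y`. -/
lemma uniquelySolvable_of_isFinitelyPresentable (hB : IsIterative B)
    {E : Coalgebra (addConst H X)} (hE : IsFinitelyPresentable.{v} E.V)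
    (p : unitCoalgebra H x ⟶ E) {Y : W} (hY : IsFinitelyPresentable.{v} Y) (y : 𝟙_ W ⟶ Y) :
    UniquelySolvable sH B p y := by
  intro g
  have := hB.existsUnique (MonoidallyLFP.tensor_fp _ _ hE hY)
    ((E.str ▷ Y) ≫ rdesc (sH.app p.f y ≫ coprod.inl) coprod.inr) g
  simpa only [IsTensorSolution, Category.assoc, rdesc_comp, coprod.inl_desc, coprod.inr_desc]
    using this

/-- Unique solvability passes to colimits. -/
lemma UniquelySolvable.of_colimit {E₀ : Coalgebra (addConst H X)} {p₀ : unitCoalgebra H x ⟶ E₀}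
    {Y₀ : W} {y₀ : 𝟙_ W ⟶ Y₀} {ι : Type*} {E : ι → Coalgebra (addConst H X)} {Y : ι → W}
    {p : ∀ i, unitCoalgebra H x ⟶ E i} {y : ∀ i, 𝟙_ W ⟶ Y i}
    (hi : ∀ i, UniquelySolvable sH B (p i) (y i))
    (h : ∀ i, E i ⟶ E₀) (k : ∀ i, Y i ⟶ Y₀) (hp : ∀ i, p i ≫ h i = p₀)
    (hy : ∀ i, y i ≫ k i = y₀)
    (ext : ∀ f g : E₀.V ⊗ Y₀ ⟶ B.a,
      (∀ i, ((h i).f ⊗ₘ k i) ≫ f = ((h i).f ⊗ₘ k i) ≫ g) → f = g)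
    (desc : ∀ t : ∀ i, (E i).V ⊗ Y i ⟶ B.a,
      (∀ i j (a : E i ⟶ E j) (b : Y i ⟶ Y j), p i ≫ a = p j → y i ≫ b = y j →
        b ≫ k j = k i → (a.f ⊗ₘ b) ≫ t j = t i) →
      ∃ s : E₀.V ⊗ Y₀ ⟶ B.a, ∀ i, ((h i).f ⊗ₘ k i) ≫ s = t i) :
    UniquelySolvable sH B p₀ y₀ := by
  intro g
  choose t ht ht' using fun i ↦ hi i ((X ◁ k i) ≫ g)
  -- Restricting the solution at stage `j` to stage `i` gives a solution there, so uniqueness makes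
  -- the `t i` compatible.
  obtain ⟨s, hs⟩ := desc t fun i j a b hpa hyb hkb ↦ ht' i _ (by
    have := (ht j).precomp a b hpa hyb
    rwa [← MonoidalCategory.whiskerLeft_comp_assoc, hkb] at this)
  refine ⟨s, ext _ _ fun i ↦ ?_, fun s' hs' ↦ ext _ _ fun i ↦ ?_⟩
  · have hE := coalgebraHom_tensor_str (h i) (k i)
    have hn := sH.naturality (p i).f p₀.f (y i) y₀ (h i).f (k i)
      (congrArg Coalgebra.Hom.f (hp i)) (hy i)
    have hti : t i = _ := ht i
    rw [hs, reassoc_of% hE, map_tensor_rdesc, reassoc_of% hn, ← H.map_comp_assoc, hs]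
    exact hti
  · rw [hs]
    exact ht' i _ (hs'.precomp (h i) (k i) (hp i) (hy i))

/-- Write `Y` as a filtered colimit of finitely presentable objects. As the unit is finitely
presentable, `y` factors through some stage `j₀`, and every stage under `j₀` is then pointed. -/
lemma uniquelySolvable_of_isFinitelyPresentable_carrier (hB : IsIterative B)
    {E : Coalgebra (addConst H X)} (hE : IsFinitelyPresentable.{v} E.V)
    (p : unitCoalgebra H x ⟶ E) {Y : W} (y : 𝟙_ W ⟶ Y) : UniquelySolvable sH B p y := by
  obtain ⟨J, _, _, P, hP⟩ := exists_filtered_presentation Y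
  obtain ⟨j₀, y₀, hy₀⟩ := exists_hom_of_isColimit P.isColimit MonoidallyLFP.unit_fp y
  have hE' := isColimitOfPreserves (tensorLeft E.V) P.isColimit
  refine UniquelySolvable.of_colimit (ι := Under j₀) (E := fun _ ↦ E)
    (Y := fun i ↦ P.diag.obj i.right) (p := fun _ ↦ p) (y := fun i ↦ y₀ ≫ P.diag.map i.hom)
    (fun i ↦ uniquelySolvable_of_isFinitelyPresentable hB hE p (hP _) _) (fun _ ↦ 𝟙 E)
    (fun i ↦ P.ι.app i.right) (fun _ ↦ Category.comp_id p) (fun i ↦ ?_) (fun f g hfg ↦ ?_)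
    (fun t ht ↦ ?_)
  · have := P.w i.hom
    rw [Category.assoc, this]
    exact hy₀
  · refine hom_ext_of_under hE' j₀ fun i ↦ ?_
    simpa using hfg i
  · obtain ⟨s, hs⟩ := exists_desc_of_under hE' j₀ t fun {i i'} a ↦ by
      have := ht i i' (𝟙 E) (P.diag.map a.right) (Category.comp_id p)
        (by rw [Category.assoc, ← P.diag.map_comp, Under.w a]) (P.w a.right)
      simpa using this
    exact ⟨s, fun i ↦ by simpa using hs i⟩

variable (H x) in
/-- A point of `X`, as a coalgebra with finitely presentable carrier. -/
noncomputable abbrev unitFpCoalgebra : FpCoalgebra (addConst H X) :=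
  ⟨unitCoalgebra H x, MonoidallyLFP.unit_fp⟩

/-- The coalgebra homomorphism from a coalgebra with finitely presentable carrier to the rational
fixpoint. -/
noncomputable abbrev injHom (E : FpCoalgebra (addConst H X)) :
    E.obj ⟶ Endofunctor.Coalgebra.mk _ (FpCoalgebra.ratStr (addConst H X)) where
  f := FpCoalgebra.inj E
  h := (FpCoalgebra.inj_ratStr E).symm

/-- The same passage to the colimit, now in the coalgebra: objects under the unit coalgebra are
exactly the pointed ones, and `- ⊗ Y` preserves the colimit. -/
lemma uniquelySolvable_ratFix (hB : IsIterative B) {Y : W} (y : 𝟙_ W ⟶ Y) :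
    UniquelySolvable sH B (injHom (unitFpCoalgebra H x)) y := by
  have := preservesColimitsOfShape_of_essentiallySmall (tensorRight Y) (FpCoalgebra (addConst H X))
  have hY := isColimitOfPreserves (tensorRight Y) (FpCoalgebra.isColimitCocone (addConst H X))
  refine UniquelySolvable.of_colimit (ι := Under (unitFpCoalgebra H x))
    (E := fun i ↦ i.right.obj) (Y := fun _ ↦ Y) (p := fun i ↦ i.hom.hom) (y := fun _ ↦ y)
    (fun i ↦ uniquelySolvable_of_isFinitelyPresentable_carrier hB i.right.property _ _)
    (fun i ↦ injHom i.right) (fun _ ↦ 𝟙 Y) (fun i ↦ ?_) (fun _ ↦ Category.comp_id y)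
    (fun f g hfg ↦ ?_) (fun t ht ↦ ?_)
  · ext
    exact FpCoalgebra.w i.hom
  · refine hom_ext_of_under hY (unitFpCoalgebra H x) fun i ↦ ?_
    have := hfg i
    rw [tensorHom_id] at this
    exact this
  · obtain ⟨s, hs⟩ := exists_desc_of_under hY (unitFpCoalgebra H x) t fun {i i'} a ↦ by
      have := ht i i' a.right.hom (𝟙 Y) (congrArg InducedCategory.Hom.hom (Under.w a))
        (Category.comp_id y) (Category.comp_id _)
      rw [tensorHom_id] at this
      exact this
    exact ⟨s, fun i ↦ by rw [tensorHom_id]; exact hs i⟩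

variable [PreservesFilteredColimits H]

variable (x) in
lemma injHom_unitFpCoalgebra : (injHom (unitFpCoalgebra H x)).f = x ≫ ratUnit H X := by
  rw [← Category.assoc]
  refine (IsIso.eq_comp_inv _).2 ((FpCoalgebra.inj_ratStr _).trans ?_)
  exact (Category.assoc _ _ _).trans (by rw [coprod.inr_map, Category.id_comp])

end TensorSolution

/-! ### Freeness with parameters. -/

section ParametrizedExtension

open Endofunctor

variable {W : Type u} [Category.{v} W] [MonoidalCategory W] {H : W ⥤ W} (sH : PointStrength H)

/-- `s : A ⊗ Y ⟶ B` extends `g : X ⊗ Y ⟶ B` along `η : X ⟶ A` and is a homomorphism with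
parameters in `Y`. -/
structure IsParamExtension {A B : Algebra H} {X Y : W} (η : X ⟶ A.a) (x : 𝟙_ W ⟶ X)
    (y : 𝟙_ W ⟶ Y) (g : X ⊗ Y ⟶ B.a) (s : A.a ⊗ Y ⟶ B.a) : Prop where
  str : (A.str ▷ Y) ≫ s = sH.app (x ≫ η) y ≫ H.map s ≫ B.str
  unit : (η ▷ Y) ≫ s = g

variable {sH}

namespace IsParamExtension

lemma precomp {A A' B : Algebra H} {X X' Y Y' : W} {η : X ⟶ A.a} {η' : X' ⟶ A'.a}
    {x : 𝟙_ W ⟶ X} {x' : 𝟙_ W ⟶ X'} {y : 𝟙_ W ⟶ Y} {y' : 𝟙_ W ⟶ Y'} {g : X' ⊗ Y' ⟶ B.a}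
    {s : A'.a ⊗ Y' ⟶ B.a} (hs : IsParamExtension sH η' x' y' g s) (a : A ⟶ A') (f : X ⟶ X')
    (k : Y ⟶ Y') (ha : η ≫ a.f = f ≫ η') (hx : x ≫ f = x') (hy : y ≫ k = y') :
    IsParamExtension sH η x y ((f ⊗ₘ k) ≫ g) ((a.f ⊗ₘ k) ≫ s) where
  str := by
    have hstr : (A.str ▷ Y) ≫ (a.f ⊗ₘ k) = (H.map a.f ⊗ₘ k) ≫ (A'.str ▷ Y') := by
      rw [← tensorHom_id, ← tensorHom_id, tensorHom_comp_tensorHom, tensorHom_comp_tensorHom,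
        a.h, Category.id_comp, Category.comp_id]
    have hn := sH.naturality (x ≫ η) (x' ≫ η') y y' a.f k
      (by rw [Category.assoc, ha, reassoc_of% hx]) hy
    rw [reassoc_of% hstr, hs.str, reassoc_of% hn, H.map_comp, Category.assoc]
  unit := by
    rw [← hs.unit, ← tensorHom_id, ← tensorHom_id, tensorHom_comp_tensorHom_assoc,
      tensorHom_comp_tensorHom_assoc, ha, Category.id_comp, Category.comp_id]

lemma postcomp {A B B' : Algebra H} {X Y : W} {η : X ⟶ A.a} {x : 𝟙_ W ⟶ X} {y : 𝟙_ W ⟶ Y}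
    {g : X ⊗ Y ⟶ B.a} {s : A.a ⊗ Y ⟶ B.a} (hs : IsParamExtension sH η x y g s) (b : B ⟶ B') :
    IsParamExtension sH η x y (g ≫ b.f) (s ≫ b.f) where
  str := by
    rw [← Category.assoc, hs.str]
    simp [b.h]
  unit := by rw [← Category.assoc, hs.unit]

/-- Extensions with parameters in a tensor product, from iterated extensions. -/
lemma tensor {A B D : Algebra H} {X Y Z : W} {η : X ⟶ A.a} {η' : X ⊗ Y ⟶ B.a} {x : 𝟙_ W ⟶ X}
    {y : 𝟙_ W ⟶ Y} {z : 𝟙_ W ⟶ Z} {g : (X ⊗ Y) ⊗ Z ⟶ D.a} {s : A.a ⊗ Y ⟶ B.a}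
    {t : B.a ⊗ Z ⟶ D.a} (hs : IsParamExtension sH η x y η' s)
    (ht : IsParamExtension sH η' (tensorPoint x y) z g t) :
    IsParamExtension sH η x (tensorPoint y z) ((α_ X Y Z).inv ≫ g)
      ((α_ A.a Y Z).inv ≫ (s ▷ Z) ≫ t) where
  str := by
    -- The extension `s` preserves points, so the strength of `H` is natural along it.
    have hp : tensorPoint (x ≫ η) y ≫ s = tensorPoint x y ≫ η' := by
      rw [← hs.unit, tensorPoint, tensorPoint, Category.assoc, Category.assoc,
        ← tensorHom_id, tensorHom_comp_tensorHom_assoc, Category.comp_id]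
    have hn := sH.naturality (tensorPoint (x ≫ η) y) (tensorPoint x y ≫ η') z z s (𝟙 Z) hp
      (Category.comp_id z)
    have htri := sH.triangle (x ≫ η) y z
    rw [← Iso.eq_inv_comp] at htri
    simp only [tensorHom_id] at hn
    calc (A.str ▷ (Y ⊗ Z)) ≫ (α_ A.a Y Z).inv ≫ (s ▷ Z) ≫ t
        = (α_ (H.obj A.a) Y Z).inv ≫ (((A.str ▷ Y) ≫ s) ▷ Z) ≫ t := by simp
      _ = (α_ (H.obj A.a) Y Z).inv ≫ (sH.app (x ≫ η) y ▷ Z) ≫ (H.map s ▷ Z) ≫ (B.str ▷ Z) ≫ t := by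
          rw [hs.str]; simp
      _ = (α_ (H.obj A.a) Y Z).inv ≫ (sH.app (x ≫ η) y ▷ Z) ≫
            sH.app (tensorPoint (x ≫ η) y) z ≫ H.map ((s ▷ Z) ≫ t) ≫ D.str := by
          rw [ht.str, reassoc_of% hn, H.map_comp, Category.assoc]
      _ = _ := by
          rw [← reassoc_of% htri, H.map_comp (α_ A.a Y Z).inv, Category.assoc]
  unit := by
    rw [associator_inv_naturality_left_assoc, ← comp_whiskerRight_assoc, hs.unit, ht.unit]

end IsParamExtension

variable [MonoidallyLFP W]

/-- The inverse of the fixpoint structure is the copairing of the algebra structure and the unit,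
and `- ⊗ Y` preserves this coproduct; the two extension conditions are the components of one tensor
equation. -/
lemma isParamExtension_iff_isTensorSolution [PreservesFilteredColimits H] {B : Algebra H}
    {X Y : W} (x : 𝟙_ W ⟶ X) (y : 𝟙_ W ⟶ Y) (g : X ⊗ Y ⟶ B.a)
    (s : (ratAlgebra H X).a ⊗ Y ⟶ B.a) :
    IsParamExtension sH (ratUnit H X) x y g s ↔
      IsTensorSolution sH B (injHom (unitFpCoalgebra H x)) y g s := by
  have hr : IsTensorSolution sH B (injHom (unitFpCoalgebra H x)) y g s ↔
      (inv (FpCoalgebra.ratStr (addConst H X)) ▷ Y) ≫ s =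
        rdesc (sH.app (x ≫ ratUnit H X) y ≫ H.map s ≫ B.str) g := by
    rw [IsTensorSolution, injHom_unitFpCoalgebra, ← inv_whiskerRight, IsIso.inv_comp_eq]
  rw [hr]
  constructor
  · intro h
    refine coprod_tensor_hom_ext ?_ ?_
    · rw [inl_rdesc, ← h.str, comp_whiskerRight, Category.assoc]
    · rw [inr_rdesc, ← h.unit, comp_whiskerRight, Category.assoc]
  · intro h
    exact
      { str := by rw [comp_whiskerRight, Category.assoc, h, inl_rdesc]
        unit := by rw [comp_whiskerRight, Category.assoc, h, inr_rdesc] }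

/-- A free iterative algebra is free with parameters. -/
theorem FreeIterativeAlgebra.existsUnique_isParamExtension [PreservesFilteredColimits H]
    {B : Algebra H} (hB : IsIterative B) {X Y : W} (F : FreeIterativeAlgebra H X)
    (x : 𝟙_ W ⟶ X) (y : 𝟙_ W ⟶ Y) (g : X ⊗ Y ⟶ B.a) :
    ∃! s : F.alg.a ⊗ Y ⟶ B.a, IsParamExtension sH F.η x y g s := by
  have hrat : ∃! s, IsParamExtension sH (A := ratAlgebra H X) (ratUnit H X) x y g s := by
    simpa only [isParamExtension_iff_isTensorSolution] using
      uniquelySolvable_ratFix (sH := sH) (x := x) hB y g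
  obtain ⟨s, hs, hs'⟩ := hrat
  -- An arbitrary free algebra is compared with the rational fixpoint; it suffices that it is a
  -- retract by `a` and `b`.
  let R := ratFreeIterativeAlgebra H X
  let a : F.alg ⟶ ratAlgebra H X := F.lift R.iterative R.η
  let b : ratAlgebra H X ⟶ F.alg := R.lift F.iterative F.η
  have ha : F.η ≫ a.f = ratUnit H X := F.η_lift R.iterative R.η
  have hb : ratUnit H X ≫ b.f = F.η := R.η_lift F.iterative F.η
  have hab : a ≫ b = 𝟙 _ := F.hom_ext F.iterative (by
    rw [Endofunctor.Algebra.comp_f, ← Category.assoc, ha, hb]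
    exact (Category.comp_id _).symm)
  replace hab : a.f ≫ b.f = 𝟙 _ := congrArg Algebra.Hom.f hab
  refine ⟨(a.f ▷ Y) ≫ s, ?_, fun t ht ↦ ?_⟩
  · simpa using hs.precomp (η := F.η) (x := x) (y := y) a (𝟙 X) (𝟙 Y) (by simp [ha]) (by simp)
      (by simp)
  · have := ht.precomp (η := ratUnit H X) (x := x) (y := y) b (𝟙 X) (𝟙 Y) (by simp [hb])
      (by simp) (by simp)
    rw [← hs' _ (by simpa using this), ← comp_whiskerRight_assoc, hab,
      id_whiskerRight, Category.id_comp]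

end ParametrizedExtension

/-! ### The point-strength of the rational monad. -/

section Main

open Endofunctor

variable {W : Type u} [Category.{v} W] [MonoidalCategory W] [MonoidallyLFP W] {H : W ⥤ W}
  (sH : PointStrength H) (F : ∀ Y : W, FreeIterativeAlgebra H Y)

/-- The homomorphism `R f`. -/
noncomputable abbrev rationalMap {Y Z : W} (f : Y ⟶ Z) : (F Y).alg ⟶ (F Z).alg :=
  (F Y).lift (F Z).iterative (f ≫ (F Z).η)

lemma η_rationalMap {Y Z : W} (f : Y ⟶ Z) :
    (F Y).η ≫ (rationalMap F f).f = f ≫ (F Z).η :=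
  (F Y).η_lift _ _

lemma isParamExtension_rightUnitor {X : W} (x : 𝟙_ W ⟶ X) :
    IsParamExtension sH (F X).η x (𝟙 (𝟙_ W)) ((ρ_ X).hom ≫ (F X).η) (ρ_ (F X).alg.a).hom where
  str := by
    rw [rightUnitor_naturality, ← sH.unit (x ≫ (F X).η), Category.assoc]
  unit := rightUnitor_naturality _

variable [PreservesFilteredColimits H]

/-- The component of the point-strength of the rational monad. -/
noncomputable def rationalStrengthApp {X Y : W} (x : 𝟙_ W ⟶ X) (y : 𝟙_ W ⟶ Y) :
    (F X).alg.a ⊗ Y ⟶ (F (X ⊗ Y)).alg.a :=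
  ((F X).existsUnique_isParamExtension (sH := sH) (F (X ⊗ Y)).iterative x y
    (F (X ⊗ Y)).η).choose

lemma isParamExtension_rationalStrengthApp {X Y : W} (x : 𝟙_ W ⟶ X) (y : 𝟙_ W ⟶ Y) :
    IsParamExtension sH (F X).η x y (F (X ⊗ Y)).η (rationalStrengthApp sH F x y) :=
  ((F X).existsUnique_isParamExtension (sH := sH) (F (X ⊗ Y)).iterative x y
    (F (X ⊗ Y)).η).choose_spec.1

variable {F} in
lemma paramExtension_ext {B : Algebra H} (hB : IsIterative B) {X Y : W} {x : 𝟙_ W ⟶ X}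
    {y : 𝟙_ W ⟶ Y} {g g' : X ⊗ Y ⟶ B.a} {s t : (F X).alg.a ⊗ Y ⟶ B.a}
    (hs : IsParamExtension sH (F X).η x y g s) (ht : IsParamExtension sH (F X).η x y g' t)
    (h : g = g') : s = t := by
  subst h
  exact ((F X).existsUnique_isParamExtension hB x y _).unique hs ht

/-- The natural transformation underlying the point-strength of the rational monad. -/
noncomputable def rationalStrengthTransformation :
    StrengthTransformation (rationalMonad F).toFunctor where
  app x y := rationalStrengthApp sH F x y
  naturality {X X' _ Y'} x x' y y' f g hx hy :=
    paramExtension_ext sH (F (X' ⊗ Y')).iterative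
      ((isParamExtension_rationalStrengthApp sH F x' y').precomp (η := (F X).η)
        (rationalMap F f) f g (η_rationalMap F f) hx hy)
      ((isParamExtension_rationalStrengthApp sH F x y).postcomp (rationalMap F (f ⊗ₘ g)))
      (η_rationalMap F (f ⊗ₘ g)).symm

/-- The point-strength of the rational monad. -/
noncomputable def rationalMonadPointStrength : MonadPointStrength (rationalMonad F) where
  toStrengthTransformation := rationalStrengthTransformation sH F
  unit {X} x :=
    paramExtension_ext sH (F X).iterative
      ((isParamExtension_rationalStrengthApp sH F x (𝟙 (𝟙_ W))).postcomp
        (rationalMap F (ρ_ X).hom))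
      (isParamExtension_rightUnitor sH F x) (η_rationalMap F (ρ_ X).hom)
  triangle {X Y Z} x y z := by
    rw [← Iso.eq_inv_comp]
    exact paramExtension_ext sH (F ((X ⊗ Y) ⊗ Z)).iterative
      ((isParamExtension_rationalStrengthApp sH F x (tensorPoint y z)).postcomp
        (rationalMap F (α_ X Y Z).inv))
      ((isParamExtension_rationalStrengthApp sH F x y).tensor
        (isParamExtension_rationalStrengthApp sH F (tensorPoint x y) z))
      (η_rationalMap F (α_ X Y Z).inv)
  preserves_unit x y := (isParamExtension_rationalStrengthApp sH F x y).unit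
  preserves_mul {X Y} x y := by
    let μ (Z : W) : (F (F Z).alg.a).alg ⟶ (F Z).alg := (F _).lift (F Z).iterative (𝟙 _)
    have hμ (Z : W) : (F (F Z).alg.a).η ≫ (μ Z).f = 𝟙 _ := (F _).η_lift _ _
    let s := rationalStrengthApp sH F x y
    -- Seen as an extension of itself along the identity, `s` composed with `μ` extends `s` along
    -- `η`; so does the other side of the multiplication law.
    have hs : IsParamExtension sH (A := (F X).alg) (𝟙 _) (x ≫ (F X).η) y s s :=
      { str := by
          rw [Category.comp_id]
          exact (isParamExtension_rationalStrengthApp sH F x y).str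
        unit := by rw [id_whiskerRight, Category.id_comp] }
    have h₁ := hs.precomp (η := (F (F X).alg.a).η) (x := x ≫ (F X).η) (y := y) (μ X) (𝟙 _)
      (𝟙 Y) (by rw [hμ, Category.comp_id]) (Category.comp_id _) (Category.comp_id _)
    have h₂ := (isParamExtension_rationalStrengthApp sH F (x ≫ (F X).η) y).postcomp
      (rationalMap F s ≫ μ (X ⊗ Y))
    have h := paramExtension_ext sH (F (X ⊗ Y)).iterative h₁ h₂ (by
      rw [Endofunctor.Algebra.comp_f, ← Category.assoc, η_rationalMap, Category.assoc, hμ,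
        Category.comp_id, id_tensorHom_id, Category.id_comp])
    rw [tensorHom_id] at h
    exact h

end Main

end RationalStrength

theorem theorem3p10 {W : Type u} [Category.{v} W] [MonoidalCategory W]
    [RationalStrength.MonoidallyLFP W] (H : W ⥤ W) [PreservesFilteredColimits H]
    (sH : RationalStrength.PointStrength H) :
    (∀ Y : W, Nonempty (RationalStrength.FreeIterativeAlgebra H Y)) ∧
    ∀ F : (∀ Y : W, RationalStrength.FreeIterativeAlgebra H Y),
      ∃ sR : RationalStrength.MonadPointStrength (RationalStrength.rationalMonad F),
        RationalStrength.IsCompatible sH F sR.toStrengthTransformation ∧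
        ∀ t : RationalStrength.StrengthTransformation (RationalStrength.rationalMonad F).toFunctor,
          RationalStrength.IsCompatible sH F t → t = sR.toStrengthTransformation :=
  ⟨fun Y ↦ ⟨RationalStrength.ratFreeIterativeAlgebra H Y⟩, fun F ↦
    ⟨RationalStrength.rationalMonadPointStrength sH F, fun {X Y} x y ↦
      let h := RationalStrength.isParamExtension_rationalStrengthApp sH F x y
      ⟨h.str, h.unit⟩, fun t ht ↦ by
        -- Compatibility of `t` says precisely that each component is a parametrized extension of
        -- `η`.
        ext X Y x y
        exact RationalStrength.paramExtension_ext sH (F (X ⊗ Y)).iterative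
          ⟨(ht x y).1, (ht x y).2⟩
          (RationalStrength.isParamExtension_rationalStrengthApp sH F x y) rfl⟩⟩
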